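/- Let $\mathcal A$ be a unital $C^*$-algebra and let $E$ be a Hilbert $\mathcal A$–$\mathcal A$-module, i.e. a complete right Hilbert $\mathcal A$-module with a nondegenerate (equivalently, unital) left action of $\mathcal A$ by adjointable operators. Let $E^{\odot 0}=\mathcal A$ and let $E^{\odot n}$ be the $n$-fold interior tensor power of $E$, so that $\langle \xi\odot X,\eta\odot Y\rangle=\langle X,\langle\xi,\eta\rangle Y\rangle$. Let $\mathcal F(E)=\bigoplus_{n\ge 0}E^{\odot n}$ be the full Fock module, with norm $\|(X_n)_n\|=\|\sum_n\langle X_n,X_n\rangle\|^{1/2}$, and regard each $E^{\odot n}$ (in particular $E=E^{\odot 1}$) as a submodule of $\mathcal F(E)$; for $X\in E^{\odot m}$ and $Y\in E^{\odot n}$ identify $X\odot Y$ with an element of $E^{\odot(m+n)}$ (for $m=0$ or $n=0$ this is the left, respectively right, action of $\mathcal A$). Let $G\subseteq E$ be a non-empty bounded subset. Then the limit $$\rho_E(G)=\lim_{n\to\infty}\ \sup_{\xi_1,\dots,\xi_n\in G}\|\xi_1\odot\cdots\odot\xi_n\|^{1/n}$$ exists. Let $\mathfrak N$ be the family of all norms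 $\mathcal N$ on the complex vector space $\mathcal F(E)$ that are equivalent to the usual norm (there is $k>0$ with $k^{-1}\|X\|\le\mathcal N(X)\le k\|X\|$ for all $X\in\mathcal F(E)$) and satisfy $\mathcal N(X\odot Y)\le\mathcal N(X)\,\mathcal N(Y)$ for all $X\in E^{\odot m}$, $Y\in E^{\odot n}$ and all $m,n\ge 0$. Then $$\rho_E(G)=\inf_{\mathcal N\in\mathfrak N}\ \sup_{\xi\in G}\mathcal N(\xi).$$ -/

import Mathlib

set_option linter.unusedSectionVars false

open Filter Topology
open scoped TensorProduct DirectSum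

/-- A Hilbert `A`–`A`-module over a unital C⋆-algebra `A`: a complete right Hilbert `A`-module with
a unital left action of `A` by adjointable operators.

`CStarModule A E` in Mathlib is written for left modules, so a right Hilbert `A`-module is a
`CStarModule Aᵐᵒᵖ E`: the right action is `ξ a = MulOpposite.op a • ξ`, and the `A`-valued inner
product is `HilbertBimodule.ip` below. For unital `A` the left action is nondegenerate exactly when
it is unital, which is part of `Module A E`. -/
class HilbertBimodule (A E : Type*) [CStarAlgebra A] [PartialOrder A] [StarOrderedRing A]
    [NormedAddCommGroup E] [NormedSpace ℂ E] [CompleteSpace E] [Module A E] [Module Aᵐᵒᵖ E]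
    extends CStarModule Aᵐᵒᵖ E, IsScalarTower ℂ A E where
  inner_left_smul : ∀ (a : A) (x y : E), inner (a • x) y = inner x (star a • y)

namespace HilbertBimodule

section InnerProduct

variable {A E : Type*} [CStarAlgebra A] [PartialOrder A] [StarOrderedRing A]
  [NormedAddCommGroup E] [NormedSpace ℂ E] [CompleteSpace E] [Module A E] [Module Aᵐᵒᵖ E]
  [HilbertBimodule A E]

variable (A) in
/-- The `A`-valued inner product `⟨x, y⟩` of a Hilbert `A`–`A`-module, conjugate linear in `x` and
linear in `y`. -/
def ip (x y : E) : A := MulOpposite.unop (inner Aᵐᵒᵖ x y)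

theorem star_ip (x y : E) : star (ip A x y) = ip A y x := by
  rw [ip, ip, ← CStarModule.star_inner x y]
  rfl

theorem ip_self_nonneg (x : E) : 0 ≤ ip A x x :=
  CStarModule.inner_self_nonneg (A := Aᵐᵒᵖ)

theorem norm_sq_eq (x : E) : ‖x‖ ^ 2 = ‖ip A x x‖ :=
  CStarModule.norm_sq_eq Aᵐᵒᵖ

theorem ip_right (x y : E) (a : A) : ip A x (MulOpposite.op a • y) = ip A x y * a := by
  simp [ip]

theorem ip_left (x y : E) (a : A) : ip A (MulOpposite.op a • x) y = star a * ip A x y := by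
  simp [ip]

theorem ip_left_smul (a : A) (x y : E) : ip A (a • x) y = ip A x (star a • y) :=
  congrArg MulOpposite.unop (HilbertBimodule.inner_left_smul a x y)

theorem ip_sum_right {ι : Type*} (s : Finset ι) (x : E) (y : ι → E) :
    ip A x (∑ i ∈ s, y i) = ∑ i ∈ s, ip A x (y i) := by
  simp [ip]

theorem ip_sum_left {ι : Type*} (s : Finset ι) (x : ι → E) (y : E) :
    ip A (∑ i ∈ s, x i) y = ∑ i ∈ s, ip A (x i) y := by
  simp [ip]

variable (A E) in
/-- The inner product as a sesquilinear map. -/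
noncomputable def ipₛₗ : E →ₗ⋆[ℂ] E →ₗ[ℂ] A :=
  LinearMap.mk₂'ₛₗ (starRingEnd ℂ) (RingHom.id ℂ) (ip A)
    (fun x x' y => by simp [ip]) (fun c x y => by simp [ip])
    (fun x y y' => by simp [ip]) (fun c x y => by simp [ip])

@[simp]
theorem ipₛₗ_apply (x y : E) : ipₛₗ A E x y = ip A x y := rfl

end InnerProduct

end HilbertBimodule

/-- A semi-inner product `A`–`A`-module: a complex vector space with commuting left and right
actions of `A` and a positive semidefinite `A`-valued form `⟨x, y⟩`, conjugate linear in `x` and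
linear in `y`, with `⟨x, y a⟩ = ⟨x, y⟩ a` and `⟨a x, y⟩ = ⟨x, a* y⟩`. -/
structure SemiBimodule.{u, w} (A : Type u) [CStarAlgebra A] [PartialOrder A] where
  carrier : Type w
  [addCommGroup : AddCommGroup carrier]
  [module : Module ℂ carrier]
  left : A →ₐ[ℂ] Module.End ℂ carrier
  right : Aᵐᵒᵖ →ₐ[ℂ] Module.End ℂ carrier
  left_right : ∀ a b x, left a (right b x) = right b (left a x)
  form : carrier →ₗ⋆[ℂ] carrier →ₗ[ℂ] A
  star_form : ∀ x y, star (form x y) = form y x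
  form_self_nonneg : ∀ x, 0 ≤ form x x
  form_right : ∀ x y a, form x (right (MulOpposite.op a) y) = form x y * a
  form_left : ∀ a x y, form (left a x) y = form x (left (star a) y)

namespace SemiBimodule

attribute [instance] SemiBimodule.addCommGroup SemiBimodule.module

section Norm

variable {A : Type*} [CStarAlgebra A] [PartialOrder A] [StarOrderedRing A] (W : SemiBimodule A)

/-- The semi-norm `‖x‖ = ‖⟨x, x⟩‖^{1/2}`. -/
noncomputable instance instNorm : Norm W.carrier := ⟨fun x => √‖W.form x x‖⟩

theorem norm_def (x : W.carrier) : ‖x‖ = √‖W.form x x‖ := rfl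

theorem norm_sq (x : W.carrier) : ‖x‖ ^ 2 = ‖W.form x x‖ := by
  rw [norm_def, Real.sq_sqrt (norm_nonneg _)]

theorem form_right_left (x y : W.carrier) (a : A) :
    W.form (W.right (MulOpposite.op a) x) y = star a * W.form x y := by
  rw [← W.star_form, W.form_right, star_mul, W.star_form]

theorem form_mul_form_le (x y : W.carrier) {s : ℝ} (hs : 0 < s) (hx : ‖W.form x x‖ ≤ s) :
    W.form y x * W.form x y ≤ s • W.form y y := by
  have h₁ : (0 : A) ≤ W.form (W.right (MulOpposite.op (W.form x y)) x - (s : ℂ) • y)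
      (W.right (MulOpposite.op (W.form x y)) x - (s : ℂ) • y) := W.form_self_nonneg _
  have h₂ : star (W.form x y) * W.form x x * W.form x y
      ≤ s • (W.form y x * W.form x y) := by
    have h := CStarAlgebra.star_left_conjugate_le_norm_smul (a := W.form x y)
      (b := W.form x x) (W.star_form x x)
    refine h.trans ?_
    rw [W.star_form]
    refine smul_le_smul_of_nonneg_right hx ?_
    rw [← W.star_form x y]
    exact star_mul_self_nonneg _
  have h₃ : W.form (W.right (MulOpposite.op (W.form x y)) x - (s : ℂ) • y)
      (W.right (MulOpposite.op (W.form x y)) x - (s : ℂ) • y)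
      = star (W.form x y) * W.form x x * W.form x y - s • (W.form y x * W.form x y)
        - s • (W.form y x * W.form x y) + s • (s • W.form y y) := by
    have e : ∀ z : A, (s : ℂ) • z = s • z := fun z => Complex.coe_smul s z
    simp only [map_sub, LinearMap.sub_apply, map_smulₛₗ, LinearMap.smul_apply,
      W.form_right, W.form_right_left, Complex.conj_ofReal, e, W.star_form, smul_sub, mul_assoc,
      RingHom.id_apply]
    abel
  rw [h₃] at h₁
  have h₄ : s • (W.form y x * W.form x y) ≤ s • (s • W.form y y) := by
    have : (0 : A) ≤ s • (s • W.form y y) - s • (W.form y x * W.form x y) := by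
      refine h₁.trans ?_
      calc _ ≤ s • (W.form y x * W.form x y) - s • (W.form y x * W.form x y)
          - s • (W.form y x * W.form x y) + s • (s • W.form y y) := by gcongr
        _ = _ := by abel
    exact sub_nonneg.mp this
  exact (smul_le_smul_iff_of_pos_left hs).mp h₄

/-- The Cauchy–Schwarz inequality. -/
theorem norm_form_le (x y : W.carrier) : ‖W.form x y‖ ≤ ‖x‖ * ‖y‖ := by
  have h : ‖W.form x y‖ ^ 2 ≤ ‖W.form x x‖ * ‖W.form y y‖ := by
    have key : ∀ s : ℝ, ‖W.form x x‖ < s → ‖W.form x y‖ ^ 2 ≤ s * ‖W.form y y‖ := by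
      intro s hs
      have hs0 : 0 < s := (norm_nonneg _).trans_lt hs
      have h := W.form_mul_form_le x y hs0 hs.le
      rw [← W.star_form x y] at h
      have h' := CStarAlgebra.norm_le_norm_of_nonneg_of_le (star_mul_self_nonneg _) h
      rw [CStarRing.norm_star_mul_self, norm_smul, Real.norm_of_nonneg hs0.le] at h'
      rwa [sq]
    have hc : Tendsto (fun s : ℝ => s * ‖W.form y y‖) (𝓝[>] ‖W.form x x‖)
        (𝓝 (‖W.form x x‖ * ‖W.form y y‖)) :=
      ((continuous_id.mul continuous_const).tendsto _).mono_left nhdsWithin_le_nhds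
    exact ge_of_tendsto hc (eventually_mem_nhdsWithin.mono fun s hs => key s hs)
  rw [norm_def, norm_def, ← Real.sqrt_mul (norm_nonneg _)]
  exact Real.le_sqrt_of_sq_le h

theorem seminormedCore : SeminormedSpace.Core ℂ W.carrier where
  norm_nonneg x := Real.sqrt_nonneg _
  norm_smul c x := by
    simp only [norm_def, map_smulₛₗ, LinearMap.smul_apply, norm_smul, RingHom.id_apply,
      RCLike.norm_conj]
    rw [← mul_assoc, Real.sqrt_mul (by positivity), Real.sqrt_mul_self (norm_nonneg _)]
  norm_triangle x y := by
    have h0 : ∀ z : W.carrier, 0 ≤ ‖z‖ := fun z => Real.sqrt_nonneg _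
    refine (pow_le_pow_iff_left₀ (h0 _) (add_nonneg (h0 _) (h0 _)) two_ne_zero).mp ?_
    calc ‖x + y‖ ^ 2 = ‖W.form x x + W.form x y + (W.form y x + W.form y y)‖ := by
          rw [norm_sq]
          simp only [map_add, LinearMap.add_apply]
          congr 1
          abel
      _ ≤ ‖W.form x x‖ + ‖W.form x y‖ + (‖W.form y x‖ + ‖W.form y y‖) :=
          (norm_add_le _ _).trans (add_le_add (norm_add_le _ _) (norm_add_le _ _))
      _ ≤ ‖x‖ ^ 2 + ‖x‖ * ‖y‖ + (‖y‖ * ‖x‖ + ‖y‖ ^ 2) := by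
          rw [norm_sq, norm_sq]
          gcongr <;> exact W.norm_form_le _ _
      _ = (‖x‖ + ‖y‖) ^ 2 := by ring

noncomputable instance instSeminormedAddCommGroup : SeminormedAddCommGroup W.carrier :=
  SeminormedAddCommGroup.ofCore W.seminormedCore

noncomputable instance instNormedSpace : NormedSpace ℂ W.carrier where
  norm_smul_le c x := (W.seminormedCore.norm_smul c x).le

/-- The Hilbert module obtained from a semi-inner product module by dividing out the vectors of
length zero and completing. -/
abbrev Hilb : Type _ := UniformSpace.Completion W.carrier

theorem norm_left_le (a : A) (x : W.carrier) : ‖W.left a x‖ ≤ ‖a‖ * ‖x‖ := by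
  have h0 : (0 : A) ≤ algebraMap ℝ A (‖a‖ ^ 2) - star a * a := by
    have h := IsSelfAdjoint.le_algebraMap_norm_self (a := star a * a)
      (IsSelfAdjoint.star_mul_self a)
    rw [CStarRing.norm_star_mul_self, ← sq] at h
    exact sub_nonneg.mpr h
  obtain ⟨b, hb⟩ := CStarAlgebra.nonneg_iff_eq_star_mul_self.mp h0
  have h1 : W.form (W.left a x) (W.left a x) ≤ (‖a‖ ^ 2) • W.form x x := by
    have h2 : (0 : A) ≤ W.form (W.left b x) (W.left b x) := W.form_self_nonneg _
    rw [W.form_left, ← Module.End.mul_apply, ← map_mul, ← hb] at h2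
    have h3 : algebraMap ℝ A (‖a‖ ^ 2) = algebraMap ℂ A ((‖a‖ ^ 2 : ℝ) : ℂ) := by
      rw [Algebra.algebraMap_eq_smul_one, Algebra.algebraMap_eq_smul_one, Complex.coe_smul]
    rw [h3, map_sub, AlgHom.commutes, LinearMap.sub_apply, map_sub, map_mul, Module.End.mul_apply,
      ← W.form_left, Module.algebraMap_end_apply, map_smul, Complex.coe_smul] at h2
    exact sub_nonneg.mp h2
  have h4 := CStarAlgebra.norm_le_norm_of_nonneg_of_le (W.form_self_nonneg _) h1
  rw [norm_smul, Real.norm_of_nonneg (by positivity), ← norm_sq, ← norm_sq, ← mul_pow] at h4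
  exact (pow_le_pow_iff_left₀ (norm_nonneg _) (by positivity) two_ne_zero).mp h4

end Norm

section Base

universe u v

variable (A : Type u) [CStarAlgebra A] [PartialOrder A] [StarOrderedRing A]

/-- `A` as a module over itself, with `⟨a, b⟩ = a* b`. (`ULift` only adjusts the universe.) -/
noncomputable def base : SemiBimodule.{u, max u v} A where
  carrier := ULift.{v} A
  left :=
    { toFun := fun a =>
        { toFun := fun x => ⟨a * x.down⟩
          map_add' := fun x y => ULift.ext _ _ (mul_add a x.down y.down)
          map_smul' := fun c x => ULift.ext _ _ (mul_smul_comm c a x.down) }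
      map_one' := LinearMap.ext fun x => ULift.ext _ _ (one_mul x.down)
      map_mul' := fun a b => LinearMap.ext fun x => ULift.ext _ _ (mul_assoc a b x.down)
      map_zero' := LinearMap.ext fun x => ULift.ext _ _ (zero_mul x.down)
      map_add' := fun a b => LinearMap.ext fun x => ULift.ext _ _ (add_mul a b x.down)
      commutes' := fun c => LinearMap.ext fun x => ULift.ext _ _ (by
        simp [Algebra.algebraMap_eq_smul_one]) }
  right :=
    { toFun := fun a =>
        { toFun := fun x => ⟨x.down * a.unop⟩
          map_add' := fun x y => ULift.ext _ _ (add_mul x.down y.down a.unop)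
          map_smul' := fun c x => ULift.ext _ _ (smul_mul_assoc c x.down a.unop) }
      map_one' := LinearMap.ext fun x => ULift.ext _ _ (mul_one x.down)
      map_mul' := fun a b =>
        LinearMap.ext fun x => ULift.ext _ _ (mul_assoc x.down b.unop a.unop).symm
      map_zero' := LinearMap.ext fun x => ULift.ext _ _ (mul_zero x.down)
      map_add' := fun a b => LinearMap.ext fun x => ULift.ext _ _ (mul_add x.down a.unop b.unop)
      commutes' := fun c => LinearMap.ext fun x => ULift.ext _ _ (by
        simp [Algebra.algebraMap_eq_smul_one]) }
  left_right a b x := ULift.ext _ _ (mul_assoc a x.down b.unop).symm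
  form := LinearMap.mk₂'ₛₗ (starRingEnd ℂ) (RingHom.id ℂ) (fun x y => star x.down * y.down)
    (fun x x' y => by simp [add_mul]) (fun c x y => by simp)
    (fun x y y' => by simp [mul_add]) (fun c x y => by simp)
  star_form x y := by simp
  form_self_nonneg x := star_mul_self_nonneg x.down
  form_right x y a := (mul_assoc (star x.down) y.down a).symm
  form_left a x y := by simp [mul_assoc]

end Base

section Tensor

universe u v w

variable {A : Type u} (E : Type v) [CStarAlgebra A] [PartialOrder A] [StarOrderedRing A]
  [NormedAddCommGroup E] [NormedSpace ℂ E] [CompleteSpace E] [Module A E] [Module Aᵐᵒᵖ E]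
  [HilbertBimodule A E]

theorem exists_negPart {M : Type*} [CStarAlgebra M] [PartialOrder M] [StarOrderedRing M] (T : M)
    (hT : IsSelfAdjoint T) :
    ∃ Q : M, T * (star Q * Q) = -((star Q * Q) * (star Q * Q)) ∧ (star Q * Q = 0 → ∃ S : M, T = star S * S) := by
  obtain ⟨Q, hQ⟩ := CStarAlgebra.nonneg_iff_eq_star_mul_self.mp (CFC.negPart_nonneg T)
  refine ⟨Q, ?_, fun h => ?_⟩
  · rw [← hQ]
    calc T * T⁻ = (T⁺ - T⁻) * T⁻ := by rw [CFC.posPart_sub_negPart T hT]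
      _ = -(T⁻ * T⁻) := by rw [sub_mul, CFC.posPart_mul_negPart, zero_sub]
  · refine CStarAlgebra.nonneg_iff_eq_star_mul_self.mp ?_
    rw [← CFC.posPart_sub_negPart T hT, hQ, h, sub_zero]
    exact CFC.posPart_nonneg T

variable {E} in
/-- The Gram matrix of finitely many vectors of a Hilbert module factors as `S* S`. -/
theorem exists_gram_factor {n : Type*} [Fintype n] [DecidableEq n] (x : n → E) :
    ∃ S : n → n → A, ∀ i j, HilbertBimodule.ip A (x i) (x j) = ∑ k, star (S k i) * S k j := by
  let T : CStarMatrix n n A := CStarMatrix.ofMatrix fun i j => HilbertBimodule.ip A (x i) (x j)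
  have hT : IsSelfAdjoint T := by
    ext i j
    rw [CStarMatrix.star_apply]
    exact HilbertBimodule.star_ip _ _
  have hpos : ∀ (B : CStarMatrix n n A) k, 0 ≤ (star B * T * B) k k := by
    intro B k
    have : (star B * T * B) k k = HilbertBimodule.ip A
        (∑ i, MulOpposite.op (B i k) • x i) (∑ j, MulOpposite.op (B j k) • x j) := by
      simp only [CStarMatrix.mul_apply, CStarMatrix.star_apply, HilbertBimodule.ip_sum_left,
        HilbertBimodule.ip_sum_right, HilbertBimodule.ip_right, HilbertBimodule.ip_left,
        Finset.sum_mul, mul_assoc]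
      rfl
    rw [this]
    exact HilbertBimodule.ip_self_nonneg _
  obtain ⟨Q, hTN, hT0⟩ := exists_negPart T hT
  obtain ⟨N, hN⟩ : ∃ N, N = star Q * Q := ⟨_, rfl⟩
  rw [← hN] at hTN hT0
  have hNsa : star N = N := by rw [hN, star_mul, star_star]
  have hcube : star N * T * N = -(star (Q * N) * (Q * N)) := by
    rw [hNsa, mul_assoc, hTN, mul_neg, star_mul, hNsa, mul_assoc N, ← mul_assoc (star Q), ← hN]
  have hQN : Q * N = 0 := by
    ext l k
    have h1 : ∑ i, star ((Q * N) i k) * (Q * N) i k ≤ 0 := by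
      have h := hpos N k
      rw [hcube, CStarMatrix.neg_apply, CStarMatrix.mul_apply] at h
      exact neg_nonneg.mp h
    have h2 := (Finset.sum_eq_zero_iff_of_nonneg fun i _ => star_mul_self_nonneg _).mp
      (le_antisymm h1 (Finset.sum_nonneg fun i _ => star_mul_self_nonneg _)) l (Finset.mem_univ l)
    exact (CStarRing.star_mul_self_eq_zero_iff _).mp h2
  have hN0 : N = 0 := by
    refine (CStarRing.star_mul_self_eq_zero_iff N).mp ?_
    rw [hNsa]
    nth_rewrite 1 [hN]
    rw [mul_assoc, hQN, mul_zero]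
  obtain ⟨S, hS⟩ := hT0 hN0
  refine ⟨fun k i => S k i, fun i j => ?_⟩
  have h := congrFun (congrFun hS i) j
  rw [CStarMatrix.mul_apply] at h
  exact h

variable (W : SemiBimodule.{u, w} A)

/-- The sesquilinear form on the algebraic tensor product `E ⊗ W` determined by
`⟨x ⊗ w, x' ⊗ w'⟩ = ⟨w, ⟨x, x'⟩ w'⟩`. -/
noncomputable def tensorForm : E ⊗[ℂ] W.carrier →ₗ⋆[ℂ] E ⊗[ℂ] W.carrier →ₗ[ℂ] A :=
  TensorProduct.lift <|
    LinearMap.mk₂'ₛₗ (starRingEnd ℂ) (starRingEnd ℂ)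
      (fun x w => TensorProduct.lift
        ((W.left.toLinearMap ∘ₗ HilbertBimodule.ipₛₗ A E x).compr₂ (W.form w)))
      (fun x x' w => TensorProduct.ext' fun y v => by simp)
      (fun c x w => TensorProduct.ext' fun y v => by simp)
      (fun x w w' => TensorProduct.ext' fun y v => by simp)
      (fun c x w => TensorProduct.ext' fun y v => by simp)

@[simp]
theorem tensorForm_tmul (x y : E) (w v : W.carrier) :
    tensorForm E W (x ⊗ₜ w) (y ⊗ₜ v) = W.form w (W.left (HilbertBimodule.ip A x y) v) := rfl

/-- The algebraic tensor product `E ⊗ W` with the semi-inner product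
`⟨x ⊗ w, x' ⊗ w'⟩ = ⟨w, ⟨x, x'⟩ w'⟩`, the left action `a (x ⊗ w) = a x ⊗ w` and the right action
`(x ⊗ w) a = x ⊗ w a`. Its completion is the interior tensor product of `E` with the completion
of `W`. -/
noncomputable def tensor : SemiBimodule.{u, max v w} A where
  carrier := E ⊗[ℂ] W.carrier
  left := (Module.End.rTensorAlgHom ℂ E W.carrier).comp (Algebra.lsmul ℂ ℂ E)
  right := (Module.End.lTensorAlgHom ℂ W.carrier E).comp W.right
  left_right a b z := by
    induction z with
    | zero => simp
    | add z z' h h' => simp only [map_add, h, h']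
    | tmul x w => rfl
  form := tensorForm E W
  star_form z z' := by
    induction z with
    | zero => simp
    | add z₁ z₂ h₁ h₂ => simp only [map_add, LinearMap.add_apply, star_add, h₁, h₂]
    | tmul x w =>
      induction z' with
      | zero => simp
      | add z₁ z₂ h₁ h₂ => simp only [map_add, LinearMap.add_apply, star_add, h₁, h₂]
      | tmul y v =>
        rw [tensorForm_tmul, tensorForm_tmul, W.star_form, W.form_left, HilbertBimodule.star_ip]
  form_self_nonneg z := by
    classical
    obtain ⟨s, rfl⟩ := TensorProduct.exists_finset z
    obtain ⟨S, hS⟩ := exists_gram_factor (A := A) fun i : s => i.1.1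
    have key : tensorForm E W (∑ i ∈ s, i.1 ⊗ₜ[ℂ] i.2) (∑ i ∈ s, i.1 ⊗ₜ[ℂ] i.2)
        = ∑ k, W.form (∑ i, W.left (S k i) i.1.2) (∑ j, W.left (S k j) j.1.2) := by
      simp only [← Finset.sum_coe_sort s, map_sum, LinearMap.sum_apply, tensorForm_tmul, hS,
        W.form_left, map_mul, Module.End.mul_apply]
      rw [Finset.sum_comm]
      refine Eq.trans ?_ (Finset.sum_congr rfl fun k _ => Finset.sum_comm)
      conv_rhs => rw [Finset.sum_comm]
      exact Finset.sum_congr rfl fun i _ => Finset.sum_comm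
    rw [key]
    exact Finset.sum_nonneg fun k _ => W.form_self_nonneg _
  form_right z z' a := by
    induction z with
    | zero => simp
    | add z₁ z₂ h₁ h₂ => simp only [map_add, LinearMap.add_apply, add_mul, h₁, h₂]
    | tmul x w =>
      induction z' with
      | zero => simp
      | add z₁ z₂ h₁ h₂ => simp only [map_add, add_mul, h₁, h₂]
      | tmul y v =>
        change tensorForm E W (x ⊗ₜ w) (y ⊗ₜ W.right (MulOpposite.op a) v) = _
        rw [tensorForm_tmul, tensorForm_tmul, W.left_right, W.form_right]
  form_left a z z' := by
    induction z with
    | zero => simp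
    | add z₁ z₂ h₁ h₂ => simp only [map_add, LinearMap.add_apply, h₁, h₂]
    | tmul x w =>
      induction z' with
      | zero => simp
      | add z₁ z₂ h₁ h₂ => simp only [map_add, h₁, h₂]
      | tmul y v =>
        change tensorForm E W ((a • x) ⊗ₜ w) (y ⊗ₜ v) = tensorForm E W (x ⊗ₜ w) ((star a • y) ⊗ₜ v)
        rw [tensorForm_tmul, tensorForm_tmul, HilbertBimodule.ip_left_smul]

end Tensor

section Sum

universe u w

variable {A : Type u} [CStarAlgebra A] [PartialOrder A] [StarOrderedRing A]
  (W : ℕ → SemiBimodule.{u, w} A)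

/-- The sesquilinear form `⟨x, y⟩ = ∑ₙ ⟨xₙ, yₙ⟩` on the algebraic direct sum. -/
noncomputable def sumForm :
    (⨁ n, (W n).carrier) →ₗ⋆[ℂ] (⨁ n, (W n).carrier) →ₗ[ℂ] A where
  toFun x := DirectSum.toModule ℂ ℕ A fun n => (W n).form (x n)
  map_add' x x' := DirectSum.linearMap_ext ℂ fun n => by
    ext y
    simp
  map_smul' c x := DirectSum.linearMap_ext ℂ fun n => by
    ext y
    simp [DirectSum.smul_apply]

theorem sumForm_of_right (x : ⨁ n, (W n).carrier) (n : ℕ) (y : (W n).carrier) :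
    sumForm W x (DirectSum.of (fun n => (W n).carrier) n y) = (W n).form (x n) y :=
  DirectSum.toModule_lof ℂ (φ := fun n => (W n).form (x n)) n y

open Classical in
theorem sumForm_apply (x y : ⨁ n, (W n).carrier) :
    sumForm W x y = ∑ n ∈ y.support, (W n).form (x n) (y n) := by
  conv_lhs => rw [← DirectSum.sum_support_of y]
  rw [map_sum]
  exact Finset.sum_congr rfl fun n _ => sumForm_of_right W x n _

/-- The algebraic direct sum, with `⟨x, y⟩ = ∑ₙ ⟨xₙ, yₙ⟩` and componentwise actions. Its completion
is the Hilbert module direct sum of the completions. -/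
noncomputable def directSum : SemiBimodule.{u, w} A where
  carrier := ⨁ n, (W n).carrier
  left := AlgHom.ofLinearMap
    { toFun := fun a => DirectSum.lmap fun n => (W n).left a
      map_add' := fun a b => by ext; simp
      map_smul' := fun c a => by ext; simp }
    (by ext; simp) (fun a b => by ext; simp)
  right := AlgHom.ofLinearMap
    { toFun := fun a => DirectSum.lmap fun n => (W n).right a
      map_add' := fun a b => by ext; simp
      map_smul' := fun c a => by ext; simp }
    (by ext; simp) (fun a b => by ext; simp)
  left_right a b x := by
    ext n
    simp [(W n).left_right]
  form := sumForm W
  star_form x y := by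
    induction x using DirectSum.induction_on with
    | zero => simp
    | add x x' h h' => simp only [map_add, LinearMap.add_apply, star_add, h, h']
    | of i x =>
      induction y using DirectSum.induction_on with
      | zero => simp
      | add y y' h h' => simp only [map_add, LinearMap.add_apply, star_add, h, h']
      | of j y =>
        rw [sumForm_of_right, sumForm_of_right]
        rcases eq_or_ne i j with rfl | h
        · simp [(W i).star_form]
        · rw [DirectSum.of_eq_of_ne _ _ _ h.symm, DirectSum.of_eq_of_ne _ _ _ h]
          simp
  form_self_nonneg x := by
    classical
    rw [sumForm_apply]
    exact Finset.sum_nonneg fun n _ => (W n).form_self_nonneg _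
  form_right x y a := by
    induction y using DirectSum.induction_on with
    | zero => simp
    | add y y' h h' => simp only [map_add, add_mul, h, h']
    | of j y =>
      change sumForm W x (DirectSum.lmap (fun n => (W n).right (MulOpposite.op a))
        (DirectSum.of (fun n => (W n).carrier) j y)) = _
      rw [DirectSum.lmap_of, sumForm_of_right, sumForm_of_right, (W j).form_right]
  form_left a x y := by
    induction y using DirectSum.induction_on with
    | zero => simp
    | add y y' h h' => simp only [map_add, h, h']
    | of j y =>
      change sumForm W (DirectSum.lmap (fun n => (W n).left a) x)
          (DirectSum.of (fun n => (W n).carrier) j y)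
        = sumForm W x (DirectSum.lmap (fun n => (W n).left (star a))
          (DirectSum.of (fun n => (W n).carrier) j y))
      rw [DirectSum.lmap_of, sumForm_of_right, sumForm_of_right, DirectSum.lmap_apply,
        (W j).form_left]

end Sum

section TensorMul

universe u v w

variable {A : Type u} (E : Type v) [CStarAlgebra A] [PartialOrder A] [StarOrderedRing A]
  [NormedAddCommGroup E] [NormedSpace ℂ E] [CompleteSpace E] [Module A E] [Module Aᵐᵒᵖ E]
  [HilbertBimodule A E] {U V W : SemiBimodule.{u, w} A}

variable {E} in
/-- The elementary tensor `x ⊗ w`. -/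
noncomputable def tmul (x : E) (w : W.carrier) : (tensor E W).carrier := x ⊗ₜ[ℂ] w

variable {E} in
theorem tensor_form_tmul (x y : E) (w v : W.carrier) :
    (tensor E W).form (tmul x w) (tmul y v) = W.form w (W.left (HilbertBimodule.ip A x y) v) := rfl

variable {E} in
theorem tensor_left_tmul (a : A) (x : E) (w : W.carrier) :
    (tensor E W).left a (tmul x w) = tmul (a • x) w := rfl

variable {E} in
theorem tensor_induction {p : (tensor E W).carrier → Prop} (z : (tensor E W).carrier)
    (h0 : p 0) (h1 : ∀ x w, p (tmul x w)) (h2 : ∀ z z', p z → p z' → p (z + z')) : p z :=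
  TensorProduct.induction_on z h0 h1 h2

/-- The bilinear map `(x ⊗ u, v) ↦ x ⊗ f u v` attached to a bilinear map `f`. -/
noncomputable def tensorMul (f : U.carrier →ₗ[ℂ] V.carrier →ₗ[ℂ] W.carrier) :
    (tensor E U).carrier →ₗ[ℂ] V.carrier →ₗ[ℂ] (tensor E W).carrier :=
  TensorProduct.lift (LinearMap.mk₂ ℂ
    (fun (x : E) (u : U.carrier) => TensorProduct.mk ℂ E W.carrier x ∘ₗ f u)
    (fun x x' u => LinearMap.ext fun v => TensorProduct.add_tmul x x' (f u v))
    (fun c x u => LinearMap.ext fun v => rfl)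
    (fun x u u' => LinearMap.ext fun v => by
      rw [map_add]
      exact TensorProduct.tmul_add x (f u v) (f u' v))
    (fun c x u => LinearMap.ext fun v => by
      rw [map_smul]
      exact TensorProduct.tmul_smul c x (f u v)))

theorem tensorMul_tmul (f : U.carrier →ₗ[ℂ] V.carrier →ₗ[ℂ] W.carrier) (x : E) (u : U.carrier)
    (v : V.carrier) : tensorMul E f (tmul x u) v = tmul x (f u v) := rfl

end TensorMul

section Extension

/-- The continuous extension of a bounded bilinear map to the completions. -/
noncomputable def extendBilin {U V H : Type*} [SeminormedAddCommGroup U] [NormedSpace ℂ U]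
    [SeminormedAddCommGroup V] [NormedSpace ℂ V] [NormedAddCommGroup H] [NormedSpace ℂ H]
    [CompleteSpace H] (f : U →L[ℂ] V →L[ℂ] H) :
    UniformSpace.Completion U →L[ℂ] UniformSpace.Completion V →L[ℂ] H :=
  ((f.extend (UniformSpace.Completion.toComplL (𝕜 := ℂ) (E := U))).flip.extend
    (UniformSpace.Completion.toComplL (𝕜 := ℂ) (E := V))).flip

theorem extendBilin_coe {U V H : Type*} [SeminormedAddCommGroup U] [NormedSpace ℂ U]
    [SeminormedAddCommGroup V] [NormedSpace ℂ V] [NormedAddCommGroup H] [NormedSpace ℂ H]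
    [CompleteSpace H] (f : U →L[ℂ] V →L[ℂ] H) (x : U) (y : V) :
    extendBilin f x y = f x y := by
  have h1 : ((f.extend (UniformSpace.Completion.toComplL (𝕜 := ℂ) (E := U))).flip.extend
      (UniformSpace.Completion.toComplL (𝕜 := ℂ) (E := V))) y
      = (f.extend (UniformSpace.Completion.toComplL (𝕜 := ℂ) (E := U))).flip y :=
    ContinuousLinearMap.extend_eq _ UniformSpace.Completion.denseRange_coe
      (UniformSpace.Completion.isUniformInducing_coe V) y
  have h2 : (f.extend (UniformSpace.Completion.toComplL (𝕜 := ℂ) (E := U))) x = f x :=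
    ContinuousLinearMap.extend_eq _ UniformSpace.Completion.denseRange_coe
      (UniformSpace.Completion.isUniformInducing_coe U) x
  rw [extendBilin, ContinuousLinearMap.flip_apply, h1, ContinuousLinearMap.flip_apply, h2]

variable {A : Type*} [CStarAlgebra A] [PartialOrder A] [StarOrderedRing A]
  {U V W : SemiBimodule A}

/-- The continuous extension of a contractive linear map to the completions. -/
noncomputable def extendMap (f : V.carrier →ₗ[ℂ] W.carrier) (hf : ∀ x, ‖f x‖ ≤ 1 * ‖x‖) :
    V.Hilb →L[ℂ] W.Hilb :=
  (UniformSpace.Completion.toComplL ∘L f.mkContinuous 1 hf).extend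
    (UniformSpace.Completion.toComplL (𝕜 := ℂ) (E := V.carrier))

theorem extendMap_coe (f : V.carrier →ₗ[ℂ] W.carrier) (hf : ∀ x, ‖f x‖ ≤ 1 * ‖x‖)
    (x : V.carrier) : extendMap f hf x = ((f x : W.carrier) : W.Hilb) :=
  ContinuousLinearMap.extend_eq _ UniformSpace.Completion.denseRange_coe
    (UniformSpace.Completion.isUniformInducing_coe V.carrier) x

/-- The continuous extension of a contractive bilinear map to the completions. -/
noncomputable def extendMap₂ (f : U.carrier →ₗ[ℂ] V.carrier →ₗ[ℂ] W.carrier)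
    (hf : ∀ x y, ‖f x y‖ ≤ 1 * ‖x‖ * ‖y‖) : U.Hilb →L[ℂ] V.Hilb →L[ℂ] W.Hilb :=
  extendBilin (ContinuousLinearMap.compL ℂ V.carrier W.carrier W.Hilb
    UniformSpace.Completion.toComplL ∘L f.mkContinuous₂ 1 hf)

theorem extendMap₂_coe (f : U.carrier →ₗ[ℂ] V.carrier →ₗ[ℂ] W.carrier)
    (hf : ∀ x y, ‖f x y‖ ≤ 1 * ‖x‖ * ‖y‖) (x : U.carrier) (y : V.carrier) :
    extendMap₂ f hf x y = ((f x y : W.carrier) : W.Hilb) :=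
  extendBilin_coe _ x y

end Extension

end SemiBimodule

namespace HilbertBimodule

open SemiBimodule

universe u v

variable (A : Type u) (E : Type v) [CStarAlgebra A] [PartialOrder A] [StarOrderedRing A]
  [NormedAddCommGroup E] [NormedSpace ℂ E] [CompleteSpace E] [Module A E] [Module Aᵐᵒᵖ E]
  [HilbertBimodule A E]

/-- The algebraic `n`-fold tensor product `E ⊗ (E ⊗ ⋯ ⊗ (E ⊗ A))` with the semi-inner product
`⟨x₁ ⊗ ⋯ ⊗ xₙ ⊗ a, y₁ ⊗ ⋯ ⊗ yₙ ⊗ b⟩ = a* ⟨xₙ, ⟨xₙ₋₁, ⋯ ⟨x₁, y₁⟩ ⋯ yₙ₋₁⟩ yₙ⟩ b`. -/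
noncomputable def algPow : ℕ → SemiBimodule.{u, max u v} A
  | 0 => base.{u, v} A
  | n + 1 => tensor E (algPow n)

variable {A E} in
/-- The elementary tensor `x ⊗ w` of `x ∈ E` and an algebraic tensor `w` of degree `n`. -/
noncomputable def algTmul {n : ℕ} (x : E) (w : (algPow A E n).carrier) :
    (algPow A E (n + 1)).carrier := tmul x w

variable {A E} in
theorem algPow_induction {n : ℕ} {p : (algPow A E (n + 1)).carrier → Prop}
    (z : (algPow A E (n + 1)).carrier) (h0 : p 0) (h1 : ∀ x w, p (algTmul x w))
    (h2 : ∀ z z', p z → p z' → p (z + z')) : p z :=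
  tensor_induction z h0 h1 h2

/-- The interior tensor power `E^{⊙ n}`. One has `E^{⊙ 0} = A`, and `E^{⊙ 1} = E ⊙ A` is identified
with `E` by `ξ ⊙ a = ξ a`. -/
abbrev TensorPow (n : ℕ) : Type (max u v) := (algPow A E n).Hilb

/-- The full Fock module `F(E) = ⨁ₙ E^{⊙ n}`, the completion of the algebraic direct sum in the norm
`‖(Xₙ)‖ = ‖∑ₙ ⟨Xₙ, Xₙ⟩‖^{1/2}`. -/
abbrev FockModule : Type (max u v) := (directSum (algPow A E)).Hilb

/-- The concatenation
`(x₁ ⊗ ⋯ ⊗ xₘ ⊗ a) (y₁ ⊗ ⋯ ⊗ yₙ ⊗ b) = x₁ ⊗ ⋯ ⊗ xₘ ⊗ a y₁ ⊗ ⋯ ⊗ yₙ ⊗ b`. -/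
noncomputable def algMul : ∀ m n : ℕ, (algPow A E m).carrier →ₗ[ℂ]
    (algPow A E n).carrier →ₗ[ℂ] (algPow A E (n + m)).carrier
  | 0, n => (algPow A E n).left.toLinearMap ∘ₗ ULift.moduleEquiv.toLinearMap
  | m + 1, n => tensorMul E (algMul m n)

theorem algMul_left (m n : ℕ) (a : A) (w : (algPow A E m).carrier) (v : (algPow A E n).carrier) :
    algMul A E m n ((algPow A E m).left a w) v
      = (algPow A E (n + m)).left a (algMul A E m n w v) := by
  cases m with
  | zero =>
    change (algPow A E n).left (a * ULift.down (α := A) w) v = _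
    rw [map_mul]
    rfl
  | succ m =>
    induction w using algPow_induction with
    | h0 => simp
    | h1 x w => rfl
    | h2 z z' h h' => simp only [map_add, LinearMap.add_apply, h, h']

theorem form_algMul (m n : ℕ) (w w' : (algPow A E m).carrier) (v v' : (algPow A E n).carrier) :
    (algPow A E (n + m)).form (algMul A E m n w v) (algMul A E m n w' v')
      = (algPow A E n).form v ((algPow A E n).left ((algPow A E m).form w w') v') := by
  induction m with
  | zero =>
    change (algPow A E n).form ((algPow A E n).left (ULift.down (α := A) w) v)
        ((algPow A E n).left (ULift.down (α := A) w') v')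
      = (algPow A E n).form v
        ((algPow A E n).left (star (ULift.down (α := A) w) * ULift.down (α := A) w') v')
    rw [(algPow A E n).form_left, map_mul]
    rfl
  | succ m ih =>
    induction w using algPow_induction with
    | h0 => simp
    | h2 z z' h h' => simp only [map_add, LinearMap.add_apply, h, h']
    | h1 x w =>
      induction w' using algPow_induction with
      | h0 => simp
      | h2 z z' h h' => simp only [map_add, LinearMap.add_apply, h, h']
      | h1 y w' =>
        change (algPow A E (n + m)).form (algMul A E m n w v)
            ((algPow A E (n + m)).left (ip A x y) (algMul A E m n w' v'))
          = (algPow A E n).form v ((algPow A E n).left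
            ((algPow A E m).form w ((algPow A E m).left (ip A x y) w')) v')
        rw [← algMul_left, ih]

theorem norm_algMul_le (m n : ℕ) (w : (algPow A E m).carrier) (v : (algPow A E n).carrier) :
    ‖algMul A E m n w v‖ ≤ 1 * ‖w‖ * ‖v‖ := by
  refine (pow_le_pow_iff_left₀ (norm_nonneg _) (by positivity) two_ne_zero).mp ?_
  rw [SemiBimodule.norm_sq, form_algMul]
  calc _ ≤ ‖v‖ * ‖(algPow A E n).left ((algPow A E m).form w w) v‖ :=
        (algPow A E n).norm_form_le _ _
    _ ≤ ‖v‖ * (‖(algPow A E m).form w w‖ * ‖v‖) := by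
        gcongr
        exact (algPow A E n).norm_left_le _ _
    _ = (1 * ‖w‖ * ‖v‖) ^ 2 := by
        rw [← SemiBimodule.norm_sq]
        ring

variable {A E} in
/-- The product `X ⊙ Y ∈ E^{⊙ (m + n)}` of `X ∈ E^{⊙ m}` and `Y ∈ E^{⊙ n}`, under the canonical
identification of `E^{⊙ m} ⊙ E^{⊙ n}` with `E^{⊙ (m + n)}`; for `m = 0` it is the left action of
`A` and for `n = 0` the right action. -/
noncomputable def odot {m n : ℕ} : TensorPow A E m →L[ℂ] TensorPow A E n →L[ℂ]
    TensorPow A E (n + m) :=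
  extendMap₂ (algMul A E m n) (norm_algMul_le A E m n)

/-- The unit `1 ∈ A`, as an element of the algebraic tensor power of degree `0`. -/
def algOne : (algPow A E 0).carrier := (⟨1⟩ : ULift.{v} A)

/-- The unit `ω = 1 ∈ A = E^{⊙ 0}`. -/
noncomputable def vacuum : TensorPow A E 0 := (algOne A E : (algPow A E 0).carrier)

variable {E} in
/-- The element `ξ = ξ ⊙ 1` of `E = E^{⊙ 1}`. -/
noncomputable def ofE (ξ : E) : TensorPow A E 1 :=
  (algTmul ξ (algOne A E) : (algPow A E 1).carrier)

theorem norm_ofE (ξ : E) : ‖ofE A ξ‖ = ‖ξ‖ := by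
  rw [ofE, UniformSpace.Completion.norm_coe, ← sq_eq_sq₀ (norm_nonneg _) (norm_nonneg _),
    SemiBimodule.norm_sq, HilbertBimodule.norm_sq_eq (A := A)]
  congr 1
  change star (1 : A) * (ip A ξ ξ * 1) = ip A ξ ξ
  simp

variable {E} in
/-- The elementary tensor `ξ₁ ⊙ ⋯ ⊙ ξₙ ∈ E^{⊙ n}` (equal to `1 ∈ A` for `n = 0`). -/
noncomputable def tprod : ∀ n : ℕ, (Fin n → E) → TensorPow A E n
  | 0, _ => vacuum A E
  | n + 1, ξ => odot (ofE A (ξ 0)) (tprod n fun i => ξ i.succ)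

/-- The inclusion of the summand of degree `n` into the algebraic direct sum. -/
noncomputable def algIncl (n : ℕ) :
    (algPow A E n).carrier →ₗ[ℂ] (directSum (algPow A E)).carrier :=
  DirectSum.lof ℂ ℕ (fun k => (algPow A E k).carrier) n

theorem norm_algIncl (n : ℕ) (w : (algPow A E n).carrier) : ‖algIncl A E n w‖ = ‖w‖ := by
  rw [← sq_eq_sq₀ (norm_nonneg _) (norm_nonneg _), SemiBimodule.norm_sq, SemiBimodule.norm_sq]
  congr 1
  refine (sumForm_of_right (algPow A E) _ n w).trans ?_
  change (algPow A E n).form (DirectSum.of (fun k => (algPow A E k).carrier) n w n) w = _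
  rw [DirectSum.of_eq_same]

variable {A E} in
/-- The isometric inclusion of the homogeneous piece `E^{⊙ n}` into `F(E)`. -/
noncomputable def incl (n : ℕ) : TensorPow A E n →L[ℂ] FockModule A E :=
  extendMap (V := algPow A E n) (W := directSum (algPow A E)) (algIncl A E n)
    (fun w => by rw [one_mul, norm_algIncl])

theorem norm_incl (n : ℕ) (X : TensorPow A E n) : ‖incl n X‖ = ‖X‖ := by
  induction X using UniformSpace.Completion.induction_on with
  | hp => exact isClosed_eq (incl n).continuous.norm continuous_norm
  | ih w =>
    rw [incl, extendMap_coe, UniformSpace.Completion.norm_coe, UniformSpace.Completion.norm_coe,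
      norm_algIncl]

variable {E} in
/-- The sequence `n ↦ sup_{ξ₁, …, ξₙ ∈ G} ‖ξ₁ ⊙ ⋯ ⊙ ξₙ‖^{1/n}`. -/
noncomputable def radiusSeq (G : Set E) (n : ℕ) : ℝ :=
  ⨆ ξ : Fin n → G, ‖tprod A n fun i => (ξ i : E)‖ ^ (1 / (n : ℝ))

variable {E} in
/-- The joint spectral radius `ρ_E(G) = limₙ sup_{ξ₁, …, ξₙ ∈ G} ‖ξ₁ ⊙ ⋯ ⊙ ξₙ‖^{1/n}`. -/
noncomputable def jointSpectralRadius (G : Set E) : ℝ := limUnder atTop (radiusSeq A G)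

variable {A E} in
/-- The norms on `F(E)` that are equivalent to the usual norm and satisfy `N(X ⊙ Y) ≤ N(X) N(Y)` for
homogeneous `X ∈ E^{⊙ m}` and `Y ∈ E^{⊙ n}`, `m, n ≥ 0`. The lower bound in `equivalent` makes the
semi-norm `N` a norm. -/
structure IsFockNorm (N : Seminorm ℂ (FockModule A E)) : Prop where
  equivalent : ∃ k : ℝ, 0 < k ∧ ∀ X, k⁻¹ * ‖X‖ ≤ N X ∧ N X ≤ k * ‖X‖
  odot_le : ∀ (m n : ℕ) (X : TensorPow A E m) (Y : TensorPow A E n),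
    N (incl (n + m) (odot X Y)) ≤ N (incl m X) * N (incl n Y)

end HilbertBimodule

/-!
The limit exists by Fekete's lemma (`exists_tendsto_rpow_inv_of_submultiplicative`). Left
multiplication by `X ∈ E^{⊙ m}` is an operator `leftMul X` on `F(E)` with `‖leftMul X‖ = ‖X‖` and
`leftMul (X ⊙ Y) = leftMul X * leftMul Y`. Consequently `‖ξ₁ ⊙ ⋯ ⊙ ξₙ‖` is the norm of a product of
the operators `leftMul ξᵢ`, and the suprema `supNorm A G n` are submultiplicative.

An admissible norm `N` satisfies `‖ξ₁ ⊙ ⋯ ⊙ ξₙ‖ ≤ K sⁿ` with `s = sup_{ξ ∈ G} N(ξ)`, so `ρ_E(G) ≤ s`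
(`jointSpectralRadius_le`).

For the converse, let `r > ρ_E(G)`. The renorming argument of Rota and Strang is carried out in two
steps. The monoid generated by the operators `r⁻¹ leftMul ξ`, `ξ ∈ G`, is bounded, and
`p(Z) = sup ‖s Z‖` over this monoid is an equivalent norm on `F(E)` with `p(ξ ⊙ Z) ≤ r p(Z)`
(`exists_seminorm_leftMul_le`). This `p` need not be submultiplicative. The Fock module is not an
algebra, but every `X ∈ F(E)` can be multiplied on the right by a homogeneous `Y`, with
`⟨X ⊙ Y, X ⊙ Y⟩ = ⟨Y, ⟨X, X⟩ Y⟩` and hence `‖X ⊙ Y‖ ≤ ‖X‖ ‖Y‖`. The norm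
`N(X) = sup {p(X ⊙ Y) : Y homogeneous, p(Y) ≤ 1}` is therefore defined on all of `F(E)`, equivalent
to the usual one (take `Y` a multiple of `1 ∈ A` for the lower bound), submultiplicative on
homogeneous elements by associativity, and at most `r` on `G`
(`exists_isFockNorm_of_seminorm`).
-/

/-! ### Multiplication of the Fock module by homogeneous elements -/

namespace HilbertBimodule

open SemiBimodule

section Fock

universe u v

variable (A : Type u) (E : Type v) [CStarAlgebra A] [PartialOrder A] [StarOrderedRing A]
  [NormedAddCommGroup E] [NormedSpace ℂ E] [CompleteSpace E] [Module A E] [Module Aᵐᵒᵖ E]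
  [HilbertBimodule A E]

theorem directSum_induction {p : (directSum (algPow A E)).carrier → Prop}
    (x : (directSum (algPow A E)).carrier) (h0 : p 0) (h1 : ∀ n w, p (algIncl A E n w))
    (h2 : ∀ x y, p x → p y → p (x + y)) : p x :=
  DirectSum.induction_on (motive := p) x h0 h1 h2

theorem form_algIncl (n : ℕ) (w w' : (algPow A E n).carrier) :
    (directSum (algPow A E)).form (algIncl A E n w) (algIncl A E n w')
      = (algPow A E n).form w w' := by
  refine (sumForm_of_right (algPow A E) _ n w').trans ?_
  change (algPow A E n).form (DirectSum.of (fun k => (algPow A E k).carrier) n w n) w' = _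
  rw [DirectSum.of_eq_same]

theorem form_algIncl_of_ne {m n : ℕ} (h : m ≠ n) (w : (algPow A E m).carrier)
    (w' : (algPow A E n).carrier) :
    (directSum (algPow A E)).form (algIncl A E m w) (algIncl A E n w') = 0 := by
  refine (sumForm_of_right (algPow A E) _ n w').trans ?_
  change (algPow A E n).form (DirectSum.of (fun k => (algPow A E k).carrier) m w n) w' = _
  rw [DirectSum.of_eq_of_ne _ _ _ h.symm, map_zero, LinearMap.zero_apply]

theorem left_algIncl (a : A) (n : ℕ) (w : (algPow A E n).carrier) :
    (directSum (algPow A E)).left a (algIncl A E n w)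
      = algIncl A E n ((algPow A E n).left a w) :=
  DirectSum.lmap_lof (R := ℂ) (fun k => (algPow A E k).left a) n w

/-- The product of a homogeneous algebraic tensor of degree `m` and an element of the algebraic
direct sum. -/
noncomputable def algLeftMul (m : ℕ) : (algPow A E m).carrier →ₗ[ℂ]
    (directSum (algPow A E)).carrier →ₗ[ℂ] (directSum (algPow A E)).carrier :=
  LinearMap.flip (DirectSum.toModule ℂ ℕ _ fun n =>
    ((algMul A E m n).compr₂ (algIncl A E (n + m))).flip)

/-- The product of an element of the algebraic direct sum and a homogeneous algebraic tensor of
degree `n`. -/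
noncomputable def algRightMul (n : ℕ) : (directSum (algPow A E)).carrier →ₗ[ℂ]
    (algPow A E n).carrier →ₗ[ℂ] (directSum (algPow A E)).carrier :=
  DirectSum.toModule ℂ ℕ _ fun m => (algMul A E m n).compr₂ (algIncl A E (n + m))

theorem algLeftMul_algIncl (m n : ℕ) (w : (algPow A E m).carrier) (v : (algPow A E n).carrier) :
    algLeftMul A E m w (algIncl A E n v) = algIncl A E (n + m) (algMul A E m n w v) :=
  LinearMap.congr_fun (DirectSum.toModule_lof ℂ
    (φ := fun n => ((algMul A E m n).compr₂ (algIncl A E (n + m))).flip) n v) w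

theorem algRightMul_algIncl (m n : ℕ) (w : (algPow A E m).carrier) (v : (algPow A E n).carrier) :
    algRightMul A E n (algIncl A E m w) v = algIncl A E (n + m) (algMul A E m n w v) :=
  LinearMap.congr_fun (DirectSum.toModule_lof ℂ
    (φ := fun m => (algMul A E m n).compr₂ (algIncl A E (n + m))) m w) v

theorem form_algLeftMul (m : ℕ) (w w' : (algPow A E m).carrier)
    (x y : (directSum (algPow A E)).carrier) :
    (directSum (algPow A E)).form (algLeftMul A E m w x) (algLeftMul A E m w' y)
      = (directSum (algPow A E)).form x
        ((directSum (algPow A E)).left ((algPow A E m).form w w') y) := by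
  induction x using directSum_induction with
  | h0 => simp
  | h2 x x' h h' => simp only [map_add, LinearMap.add_apply, h, h']
  | h1 i v =>
    induction y using directSum_induction with
    | h0 => simp
    | h2 y y' h h' => simp only [map_add, h, h']
    | h1 j v' =>
      rw [algLeftMul_algIncl, algLeftMul_algIncl, left_algIncl]
      rcases eq_or_ne i j with rfl | h
      · rw [form_algIncl, form_algIncl, form_algMul]
      · rw [form_algIncl_of_ne A E h, form_algIncl_of_ne A E (by omega)]

/-- This identity is the reason that right multiplication by a homogeneous element is bounded on
all of `F(E)`: the summands `xᵢ ⊗ v` stay orthogonal, and their inner products add up to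
`⟨v, ⟨x, x⟩ v⟩`. -/
theorem form_algRightMul (n : ℕ) (x y : (directSum (algPow A E)).carrier)
    (v v' : (algPow A E n).carrier) :
    (directSum (algPow A E)).form (algRightMul A E n x v) (algRightMul A E n y v')
      = (algPow A E n).form v
        ((algPow A E n).left ((directSum (algPow A E)).form x y) v') := by
  induction x using directSum_induction with
  | h0 => simp
  | h2 x x' h h' => simp only [map_add, LinearMap.add_apply, h, h']
  | h1 i w =>
    induction y using directSum_induction with
    | h0 => simp
    | h2 y y' h h' => simp only [map_add, LinearMap.add_apply, h, h']
    | h1 j w' =>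
      rw [algRightMul_algIncl, algRightMul_algIncl]
      rcases eq_or_ne i j with rfl | h
      · rw [form_algIncl, form_algIncl, form_algMul]
      · rw [form_algIncl_of_ne A E h, form_algIncl_of_ne A E (by omega)]
        simp

theorem norm_algLeftMul_le (m : ℕ) (w : (algPow A E m).carrier)
    (x : (directSum (algPow A E)).carrier) :
    ‖algLeftMul A E m w x‖ ≤ 1 * ‖w‖ * ‖x‖ := by
  refine (pow_le_pow_iff_left₀ (norm_nonneg _) (by positivity) two_ne_zero).mp ?_
  rw [SemiBimodule.norm_sq, form_algLeftMul]
  calc _ ≤ ‖x‖ * ‖(directSum (algPow A E)).left ((algPow A E m).form w w) x‖ :=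
        (directSum (algPow A E)).norm_form_le _ _
    _ ≤ ‖x‖ * (‖(algPow A E m).form w w‖ * ‖x‖) := by
        gcongr
        exact (directSum (algPow A E)).norm_left_le _ _
    _ = (1 * ‖w‖ * ‖x‖) ^ 2 := by
        rw [← SemiBimodule.norm_sq]
        ring

theorem norm_algRightMul_le (n : ℕ) (x : (directSum (algPow A E)).carrier)
    (v : (algPow A E n).carrier) :
    ‖algRightMul A E n x v‖ ≤ 1 * ‖x‖ * ‖v‖ := by
  refine (pow_le_pow_iff_left₀ (norm_nonneg _) (by positivity) two_ne_zero).mp ?_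
  rw [SemiBimodule.norm_sq, form_algRightMul]
  calc _ ≤ ‖v‖ * ‖(algPow A E n).left ((directSum (algPow A E)).form x x) v‖ :=
        (algPow A E n).norm_form_le _ _
    _ ≤ ‖v‖ * (‖(directSum (algPow A E)).form x x‖ * ‖v‖) := by
        gcongr
        exact (algPow A E n).norm_left_le _ _
    _ = (1 * ‖x‖ * ‖v‖) ^ 2 := by
        rw [← SemiBimodule.norm_sq]
        ring

theorem algLeftMul_algTmul_algOne (x : E) (n : ℕ) (z : (algPow A E n).carrier) :
    algLeftMul A E 1 (algTmul x (algOne A E)) (algIncl A E n z)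
      = algIncl A E (n + 1) (algTmul x z) := by
  rw [algLeftMul_algIncl]
  change algIncl A E (n + 1) (algTmul x ((algPow A E n).left 1 z)) = _
  rw [map_one, Module.End.one_apply]

/-- Associativity of concatenation. The two sides lie in `algPow` of the propositionally equal
degrees `p + (n + m)` and `p + n + m`, so they are compared in the direct sum. -/
theorem algIncl_algMul_assoc (m n p : ℕ) (w : (algPow A E m).carrier)
    (v : (algPow A E n).carrier) (u : (algPow A E p).carrier) :
    algIncl A E (p + (n + m)) (algMul A E (n + m) p (algMul A E m n w v) u)
      = algIncl A E (p + n + m) (algMul A E m (p + n) w (algMul A E n p v u)) := by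
  induction m with
  | zero => exact congrArg (algIncl A E (p + n)) (algMul_left A E n p (ULift.down (α := A) w) v u)
  | succ m ih =>
    induction w using algPow_induction with
    | h0 => simp
    | h2 z z' h h' => simp only [map_add, LinearMap.add_apply, h, h']
    | h1 x w =>
      change algIncl A E (p + (n + m) + 1)
          (algTmul x (algMul A E (n + m) p (algMul A E m n w v) u))
        = algIncl A E (p + n + m + 1) (algTmul x (algMul A E m (p + n) w (algMul A E n p v u)))
      rw [← algLeftMul_algTmul_algOne, ← algLeftMul_algTmul_algOne, ih]

theorem algLeftMul_algMul (m n : ℕ) (w : (algPow A E m).carrier) (v : (algPow A E n).carrier)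
    (x : (directSum (algPow A E)).carrier) :
    algLeftMul A E (n + m) (algMul A E m n w v) x
      = algLeftMul A E m w (algLeftMul A E n v x) := by
  induction x using directSum_induction with
  | h0 => simp
  | h2 x x' h h' => simp only [map_add, h, h']
  | h1 p u =>
    rw [algLeftMul_algIncl, algLeftMul_algIncl, algLeftMul_algIncl, algIncl_algMul_assoc]

theorem algLeftMul_algOne (x : (directSum (algPow A E)).carrier) :
    algLeftMul A E 0 (algOne A E) x = x := by
  induction x using directSum_induction with
  | h0 => simp
  | h2 x x' h h' => simp only [map_add, h, h']
  | h1 p u =>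
    rw [algLeftMul_algIncl]
    change algIncl A E p ((algPow A E p).left 1 u) = _
    rw [map_one, Module.End.one_apply]

/-- The right unit law. The degree `0 + m` is only propositionally equal to `m`, so the two sides
are compared in the direct sum. -/
theorem algMul_algOne (m : ℕ) (w : (algPow A E m).carrier) :
    algIncl A E (0 + m) (algMul A E m 0 w (algOne A E)) = algIncl A E m w := by
  induction m with
  | zero =>
    refine congrArg (algIncl A E 0) ?_
    exact ULift.ext _ _ (mul_one (ULift.down (α := A) w))
  | succ m ih =>
    induction w using algPow_induction with
    | h0 => simp
    | h2 z z' h h' => simp only [map_add, LinearMap.add_apply, h, h']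
    | h1 x w =>
      change algIncl A E (0 + m + 1) (algTmul x (algMul A E m 0 w (algOne A E))) = _
      rw [← algLeftMul_algTmul_algOne, ← algLeftMul_algTmul_algOne, ih]

variable {A E} in
/-- The product `X ⊙ Z` of `X ∈ E^{⊙ m}` and `Z ∈ F(E)`. -/
noncomputable def leftMul {m : ℕ} :
    TensorPow A E m →L[ℂ] FockModule A E →L[ℂ] FockModule A E :=
  extendMap₂ (U := algPow A E m) (V := directSum (algPow A E)) (W := directSum (algPow A E))
    (algLeftMul A E m) (norm_algLeftMul_le A E m)

variable {A E} in
/-- The product `Z ⊙ Y` of `Z ∈ F(E)` and `Y ∈ E^{⊙ n}`. -/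
noncomputable def rightMul {n : ℕ} :
    FockModule A E →L[ℂ] TensorPow A E n →L[ℂ] FockModule A E :=
  extendMap₂ (U := directSum (algPow A E)) (V := algPow A E n) (W := directSum (algPow A E))
    (algRightMul A E n) (norm_algRightMul_le A E n)

variable {A E}

theorem leftMul_coe {m : ℕ} (w : (algPow A E m).carrier)
    (x : (directSum (algPow A E)).carrier) :
    leftMul (w : TensorPow A E m) (x : FockModule A E)
      = ((algLeftMul A E m w x : (directSum (algPow A E)).carrier) : FockModule A E) :=
  extendMap₂_coe _ _ _ _

theorem rightMul_coe {n : ℕ} (x : (directSum (algPow A E)).carrier)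
    (v : (algPow A E n).carrier) :
    rightMul (x : FockModule A E) (v : TensorPow A E n)
      = ((algRightMul A E n x v : (directSum (algPow A E)).carrier) : FockModule A E) :=
  extendMap₂_coe _ _ _ _

theorem odot_coe {m n : ℕ} (w : (algPow A E m).carrier) (v : (algPow A E n).carrier) :
    odot (w : TensorPow A E m) (v : TensorPow A E n)
      = ((algMul A E m n w v : (algPow A E (n + m)).carrier) : TensorPow A E (n + m)) :=
  extendMap₂_coe _ _ _ _

theorem incl_coe {n : ℕ} (w : (algPow A E n).carrier) :
    incl n (w : TensorPow A E n)
      = ((algIncl A E n w : (directSum (algPow A E)).carrier) : FockModule A E) :=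
  extendMap_coe _ _ _

theorem norm_leftMul_apply_le {m : ℕ} (X : TensorPow A E m) (Z : FockModule A E) :
    ‖leftMul X Z‖ ≤ ‖X‖ * ‖Z‖ := by
  induction X, Z using UniformSpace.Completion.induction_on₂ with
  | hp => exact isClosed_le (by fun_prop) (by fun_prop)
  | ih w x =>
    rw [leftMul_coe]
    simpa only [UniformSpace.Completion.norm_coe, one_mul] using norm_algLeftMul_le A E m w x

theorem norm_rightMul_apply_le {n : ℕ} (Z : FockModule A E) (Y : TensorPow A E n) :
    ‖rightMul Z Y‖ ≤ ‖Z‖ * ‖Y‖ := by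
  induction Z, Y using UniformSpace.Completion.induction_on₂ with
  | hp => exact isClosed_le (by fun_prop) (by fun_prop)
  | ih x v =>
    rw [rightMul_coe]
    simpa only [UniformSpace.Completion.norm_coe, one_mul] using norm_algRightMul_le A E n x v

theorem leftMul_incl {m n : ℕ} (X : TensorPow A E m) (Y : TensorPow A E n) :
    leftMul X (incl n Y) = incl (n + m) (odot X Y) := by
  induction X, Y using UniformSpace.Completion.induction_on₂ with
  | hp => exact isClosed_eq (by fun_prop) (by fun_prop)
  | ih w v => rw [incl_coe, leftMul_coe, odot_coe, incl_coe, algLeftMul_algIncl]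

theorem rightMul_incl {m n : ℕ} (X : TensorPow A E m) (Y : TensorPow A E n) :
    rightMul (incl m X) Y = incl (n + m) (odot X Y) := by
  induction X, Y using UniformSpace.Completion.induction_on₂ with
  | hp => exact isClosed_eq (by fun_prop) (by fun_prop)
  | ih w v => rw [incl_coe, rightMul_coe, odot_coe, incl_coe, algRightMul_algIncl]

theorem leftMul_odot {m n : ℕ} (X : TensorPow A E m) (Y : TensorPow A E n) :
    leftMul (odot X Y) = leftMul X * leftMul Y := by
  ext Z
  rw [mul_apply_eq_comp]
  induction X, Y, Z using UniformSpace.Completion.induction_on₃ with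
  | hp => exact isClosed_eq (by fun_prop) (by fun_prop)
  | ih w v x => rw [odot_coe, leftMul_coe, leftMul_coe, leftMul_coe, algLeftMul_algMul]

theorem rightMul_incl_odot {m n p : ℕ} (X : TensorPow A E m) (Y : TensorPow A E n)
    (Z : TensorPow A E p) :
    rightMul (incl (n + m) (odot X Y)) Z = rightMul (incl m X) (odot Y Z) := by
  rw [rightMul_incl, rightMul_incl, ← leftMul_incl, ← leftMul_incl, leftMul_odot,
    mul_apply_eq_comp, leftMul_incl Y]

variable (A E) in
theorem leftMul_vacuum : leftMul (vacuum A E) = 1 := by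
  ext Z
  rw [one_apply_eq_self]
  induction Z using UniformSpace.Completion.induction_on with
  | hp => exact isClosed_eq (by fun_prop) (by fun_prop)
  | ih x => rw [vacuum, leftMul_coe, algLeftMul_algOne]

theorem incl_odot_vacuum {m : ℕ} (X : TensorPow A E m) :
    incl (0 + m) (odot X (vacuum A E)) = incl m X := by
  induction X using UniformSpace.Completion.induction_on with
  | hp => exact isClosed_eq (by fun_prop) (by fun_prop)
  | ih w => rw [vacuum, odot_coe, incl_coe, incl_coe, algMul_algOne]

theorem rightMul_vacuum (Z : FockModule A E) : rightMul Z (vacuum A E) = Z := by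
  induction Z using UniformSpace.Completion.induction_on with
  | hp => exact isClosed_eq (by fun_prop) (by fun_prop)
  | ih x =>
    induction x using directSum_induction with
    | h0 => rw [UniformSpace.Completion.coe_zero, map_zero, zero_apply]
    | h2 x y hx hy =>
      rw [UniformSpace.Completion.coe_add, map_add, add_apply, hx, hy]
    | h1 n w => rw [← incl_coe, rightMul_incl, incl_odot_vacuum]

variable (A E) in
theorem norm_vacuum_le : ‖vacuum A E‖ ≤ 1 := by
  rw [vacuum, UniformSpace.Completion.norm_coe, ← sq_le_one_iff₀ (norm_nonneg _),
    SemiBimodule.norm_sq]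
  change ‖star (1 : A) * 1‖ ≤ 1
  rcases subsingleton_or_nontrivial A with h | h
  · rw [Subsingleton.elim (star (1 : A) * 1) 0, norm_zero]
    exact zero_le_one
  · rw [star_one, one_mul, CStarRing.norm_one]

theorem norm_leftMul {m : ℕ} (X : TensorPow A E m) : ‖leftMul X‖ = ‖X‖ := by
  refine le_antisymm (ContinuousLinearMap.opNorm_le_bound _ (norm_nonneg _)
    (norm_leftMul_apply_le X)) ?_
  calc ‖X‖ = ‖leftMul X (incl 0 (vacuum A E))‖ := by
        rw [leftMul_incl, incl_odot_vacuum, norm_incl]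
    _ ≤ ‖leftMul X‖ * ‖incl 0 (vacuum A E)‖ := (leftMul X).le_opNorm _
    _ ≤ ‖leftMul X‖ := by
        rw [norm_incl]
        exact mul_le_of_le_one_right (norm_nonneg _) (norm_vacuum_le A E)

end Fock

end HilbertBimodule

/-! ### Submultiplicative sequences and bounded monoids of operators -/

/-- Fekete's lemma in multiplicative form. No lower bound on `a n ^ (1 / n)` is needed beyond
nonnegativity: the limit may be `0`. -/
theorem exists_tendsto_rpow_inv_of_submultiplicative {a : ℕ → ℝ} (h0 : ∀ n, 0 ≤ a n)
    (h : ∀ m n, a (m + n) ≤ a m * a n) :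
    ∃ l, Tendsto (fun n : ℕ => a n ^ (1 / (n : ℝ))) atTop (𝓝 l) := by
  -- If some term vanishes, all later ones do; otherwise the additive version applies to `log a`.
  by_cases hz : ∃ k, a k = 0
  · obtain ⟨k, hk⟩ := hz
    refine ⟨0, tendsto_const_nhds.congr' ?_⟩
    filter_upwards [eventually_ge_atTop k, eventually_ne_atTop 0] with n hn hn0
    obtain ⟨j, rfl⟩ := Nat.exists_eq_add_of_le hn
    have : a (k + j) = 0 := le_antisymm ((h k j).trans (by rw [hk, zero_mul])) (h0 _)
    rw [this, Real.zero_rpow (by positivity)]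
  · push Not at hz
    have hpos : ∀ n, 0 < a n := fun n => (h0 n).lt_of_ne' (hz n)
    have hsub : Subadditive fun n => Real.log (a n) := fun m n =>
      (Real.log_le_log (hpos _) (h m n)).trans_eq (Real.log_mul (hz m) (hz n))
    have hexp : ∀ n : ℕ, a n ^ (1 / (n : ℝ)) = Real.exp (Real.log (a n) / n) := fun n => by
      rw [Real.rpow_def_of_pos (hpos n), mul_one_div]
    simp only [hexp]
    by_cases hb : BddBelow (Set.range fun n : ℕ => Real.log (a n) / n)
    · exact ⟨_, (Real.continuous_exp.tendsto _).comp (hsub.tendsto_lim hb)⟩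
    -- `Subadditive.tendsto_lim` does not cover this case: here `log (a n) / n` tends to `-∞`.
    · refine ⟨0, Real.tendsto_exp_atBot.comp (tendsto_atBot.2 fun b => ?_)⟩
      obtain ⟨_, ⟨n, rfl⟩, hn⟩ := not_bddBelow_iff.1 hb (min b 0)
      -- The value at `n = 0` is the junk value `0`, excluded by the bound `min b 0`.
      have hn0 : n ≠ 0 := by
        rintro rfl
        simp at hn
      exact (hsub.eventually_div_lt_of_div_lt hn0 (hn.trans_le (min_le_left _ _))).mono
        fun _ => le_of_lt

/-- A bounded monoid of operators acts by contractions for an equivalent norm, namely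
`x ↦ sup_{s ∈ S} ‖s x‖`. -/
theorem exists_seminorm_forall_mem_le {F : Type*} [SeminormedAddCommGroup F] [NormedSpace ℂ F]
    (S : Submonoid (F →L[ℂ] F)) {M : ℝ} (hM : ∀ s ∈ S, ‖s‖ ≤ M) :
    ∃ p : Seminorm ℂ F, (∀ x, ‖x‖ ≤ p x) ∧ (∀ x, p x ≤ M * ‖x‖) ∧
      ∀ s ∈ S, ∀ x, p (s x) ≤ p x := by
  let q : S → Seminorm ℂ F := fun s => (normSeminorm ℂ F).comp (s : F →L[ℂ] F).toLinearMap
  have hq : ∀ s x, q s x ≤ M * ‖x‖ := fun s x =>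
    ((s : F →L[ℂ] F).le_opNorm x).trans (by gcongr; exact hM s s.2)
  have hbdd : BddAbove (Set.range q) :=
    Seminorm.bddAbove_range_iff.2 fun x => ⟨_, Set.forall_mem_range.2 fun s => hq s x⟩
  have hle : ∀ s x, q s x ≤ (⨆ s, q s) x := fun s x => by
    rw [Seminorm.iSup_apply hbdd]
    exact le_ciSup (f := fun s => q s x) ⟨_, Set.forall_mem_range.2 fun s => hq s x⟩ s
  refine ⟨⨆ s, q s, fun x => hle 1 x, fun x => ?_, fun s hs x => ?_⟩
  · rw [Seminorm.iSup_apply hbdd]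
    exact ciSup_le fun s => hq s x
  · rw [Seminorm.iSup_apply hbdd]
    exact ciSup_le fun t => hle (t * (⟨s, hs⟩ : S)) x

namespace HilbertBimodule

open SemiBimodule

/-! ### The joint spectral radius -/

section Radius

variable {A E : Type*} [CStarAlgebra A] [PartialOrder A] [StarOrderedRing A]
  [NormedAddCommGroup E] [NormedSpace ℂ E] [CompleteSpace E] [Module A E] [Module Aᵐᵒᵖ E]
  [HilbertBimodule A E]

theorem leftMul_tprod (n : ℕ) (ξ : Fin n → E) :
    leftMul (tprod A n ξ) = (List.ofFn fun i => leftMul (ofE A (ξ i))).prod := by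
  induction n with
  | zero => exact leftMul_vacuum A E
  | succ n ih =>
    rw [List.ofFn_succ, List.prod_cons, ← ih]
    exact leftMul_odot _ _

theorem norm_tprod_add_le (m n : ℕ) (ξ : Fin (m + n) → E) :
    ‖tprod A (m + n) ξ‖ ≤ ‖tprod A m fun i => ξ (i.castAdd n)‖
      * ‖tprod A n fun i => ξ (i.natAdd m)‖ := by
  rw [← norm_leftMul, ← norm_leftMul, ← norm_leftMul, leftMul_tprod, leftMul_tprod, leftMul_tprod,
    List.ofFn_add, List.prod_append]
  exact norm_mul_le _ _

theorem norm_odot_le {m n : ℕ} (X : TensorPow A E m) (Y : TensorPow A E n) :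
    ‖odot X Y‖ ≤ ‖X‖ * ‖Y‖ := by
  rw [← norm_incl, ← leftMul_incl, ← norm_incl A E n Y]
  exact norm_leftMul_apply_le X _

variable {G : Set E} {C : ℝ}

theorem norm_tprod_le (hC : ∀ ξ ∈ G, ‖ξ‖ ≤ C) (n : ℕ) (ξ : Fin n → G) :
    ‖tprod A n fun i => (ξ i : E)‖ ≤ C ^ n := by
  induction n with
  | zero => exact (norm_vacuum_le A E).trans_eq (pow_zero C).symm
  | succ n ih =>
    have hC0 : 0 ≤ C := (norm_nonneg _).trans (hC _ (ξ 0).2)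
    rw [pow_succ']
    refine (norm_odot_le _ _).trans (mul_le_mul ?_ (ih fun i => ξ i.succ) (norm_nonneg _) hC0)
    rw [norm_ofE]
    exact hC _ (ξ 0).2

theorem bddAbove_norm_tprod (A : Type*) [CStarAlgebra A] [PartialOrder A] [StarOrderedRing A]
    [Module A E] [Module Aᵐᵒᵖ E] [HilbertBimodule A E] (hC : ∀ ξ ∈ G, ‖ξ‖ ≤ C) (n : ℕ) :
    BddAbove (Set.range fun ξ : Fin n → G => ‖tprod A n fun i => (ξ i : E)‖) :=
  ⟨C ^ n, Set.forall_mem_range.2 (norm_tprod_le hC n)⟩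

variable (A G) in
/-- The supremum of `‖ξ₁ ⊙ ⋯ ⊙ ξₙ‖` over `ξ₁, …, ξₙ ∈ G`. -/
noncomputable def supNorm (n : ℕ) : ℝ := ⨆ ξ : Fin n → G, ‖tprod A n fun i => (ξ i : E)‖

theorem supNorm_nonneg (n : ℕ) : 0 ≤ supNorm A G n := Real.iSup_nonneg fun _ => norm_nonneg _

theorem norm_tprod_le_supNorm (hC : ∀ ξ ∈ G, ‖ξ‖ ≤ C) {n : ℕ} (ξ : Fin n → G) :
    ‖tprod A n fun i => (ξ i : E)‖ ≤ supNorm A G n :=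
  le_ciSup (bddAbove_norm_tprod A hC n) ξ

theorem supNorm_add_le (hC : ∀ ξ ∈ G, ‖ξ‖ ≤ C) (m n : ℕ) :
    supNorm A G (m + n) ≤ supNorm A G m * supNorm A G n :=
  Real.iSup_le (fun ξ => (norm_tprod_add_le m n fun i => (ξ i : E)).trans
    (mul_le_mul (norm_tprod_le_supNorm hC fun i => ξ (i.castAdd n))
      (norm_tprod_le_supNorm hC fun i => ξ (i.natAdd m)) (norm_nonneg _) (supNorm_nonneg _)))
    (mul_nonneg (supNorm_nonneg _) (supNorm_nonneg _))

theorem radiusSeq_eq (hne : G.Nonempty) (hC : ∀ ξ ∈ G, ‖ξ‖ ≤ C) {n : ℕ} (hn : n ≠ 0) :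
    radiusSeq A G n = supNorm A G n ^ (1 / (n : ℝ)) := by
  have : Nonempty G := hne.to_subtype
  have hle : ∀ ξ : Fin n → G, ‖tprod A n fun i => (ξ i : E)‖ ^ (1 / (n : ℝ))
      ≤ supNorm A G n ^ (1 / (n : ℝ)) := fun ξ =>
    Real.rpow_le_rpow (norm_nonneg _) (norm_tprod_le_supNorm hC ξ) (by positivity)
  refine le_antisymm (ciSup_le hle) ?_
  have h0 : 0 ≤ radiusSeq A G n := Real.iSup_nonneg fun _ => by positivity
  rw [one_div, ← Real.pow_rpow_inv_natCast h0 hn]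
  refine Real.rpow_le_rpow (supNorm_nonneg n) (ciSup_le fun ξ => ?_) (by positivity)
  rw [← Real.rpow_inv_natCast_pow (norm_nonneg (tprod A n fun i => (ξ i : E))) hn, ← one_div]
  gcongr
  exact le_ciSup (f := fun ξ : Fin n → G => ‖tprod A n fun i => (ξ i : E)‖ ^ (1 / (n : ℝ)))
    ⟨_, Set.forall_mem_range.2 hle⟩ ξ

theorem tendsto_radiusSeq (hne : G.Nonempty) (hC : ∀ ξ ∈ G, ‖ξ‖ ≤ C) :
    Tendsto (radiusSeq A G) atTop (𝓝 (jointSpectralRadius A G)) := by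
  obtain ⟨l, hl⟩ := exists_tendsto_rpow_inv_of_submultiplicative (a := supNorm A G) supNorm_nonneg
    (supNorm_add_le hC)
  exact tendsto_nhds_limUnder ⟨l, hl.congr' ((eventually_ne_atTop 0).mono fun n hn =>
    (radiusSeq_eq hne hC hn).symm)⟩

/-- If `r > ρ_E(G)`, the set of all `r⁻ⁿ ξ₁ ⊙ ⋯ ⊙ ξₙ` is bounded. -/
theorem exists_norm_tprod_le_mul_pow (hne : G.Nonempty) (hC : ∀ ξ ∈ G, ‖ξ‖ ≤ C) {r : ℝ}
    (hr0 : 0 < r) (hr : jointSpectralRadius A G < r) :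
    ∃ M > 0, ∀ (n : ℕ) (ξ : Fin n → G), ‖tprod A n fun i => (ξ i : E)‖ ≤ M * r ^ n := by
  have hev : ∀ᶠ n in atTop, supNorm A G n / r ^ n ≤ 1 := by
    filter_upwards [(tendsto_radiusSeq hne hC).eventually_lt_const hr, eventually_ne_atTop 0]
      with n hn hn0
    rw [radiusSeq_eq hne hC hn0, one_div] at hn
    rw [div_le_one (by positivity), ← Real.rpow_inv_natCast_pow (supNorm_nonneg n) hn0]
    exact pow_le_pow_left₀ (Real.rpow_nonneg (supNorm_nonneg n) _) hn.le n
  obtain ⟨M, hM⟩ := IsBoundedUnder.bddAbove_range ⟨1, eventually_map.2 hev⟩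
  refine ⟨max M 1, by positivity, fun n ξ => (norm_tprod_le_supNorm hC ξ).trans ?_⟩
  rw [← div_le_iff₀ (by positivity)]
  exact (hM ⟨n, rfl⟩).trans (le_max_left _ _)

/-- The lower bound `ρ_E(G) ≤ sup_{ξ ∈ G} N(ξ)`: submultiplicativity and equivalence of `N` with
the norm give `‖ξ₁ ⊙ ⋯ ⊙ ξₙ‖ ≤ K (sup_{ξ ∈ G} N(ξ))ⁿ`. -/
theorem jointSpectralRadius_le (hne : G.Nonempty) (hC : ∀ ξ ∈ G, ‖ξ‖ ≤ C)
    {N : Seminorm ℂ (FockModule A E)} (hN : IsFockNorm N) :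
    jointSpectralRadius A G ≤ ⨆ ξ : G, N (incl 1 (ofE A (ξ : E))) := by
  have : Nonempty G := hne.to_subtype
  obtain ⟨k, hk, hkN⟩ := hN.equivalent
  set s : ℝ := ⨆ ξ : G, N (incl 1 (ofE A (ξ : E)))
  have hs0 : 0 ≤ s := Real.iSup_nonneg fun _ => apply_nonneg N _
  have hbdd : BddAbove (Set.range fun ξ : G => N (incl 1 (ofE A (ξ : E)))) := by
    refine ⟨k * C, Set.forall_mem_range.2 fun ξ => (hkN _).2.trans ?_⟩
    rw [norm_incl, norm_ofE]
    gcongr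
    exact hC _ ξ.2
  have hNt : ∀ (n : ℕ) (ξ : Fin n → G),
      N (incl n (tprod A n fun i => (ξ i : E))) ≤ s ^ n * N (incl 0 (vacuum A E)) := by
    intro n
    induction n with
    | zero => exact fun ξ => by rw [pow_zero, one_mul]; rfl
    | succ n ih =>
      intro ξ
      rw [pow_succ', mul_assoc]
      exact (hN.odot_le 1 n _ _).trans (mul_le_mul (le_ciSup hbdd (ξ 0)) (ih fun i => ξ i.succ)
        (apply_nonneg N _) hs0)
  -- The summand `1` makes `K` positive also when `F(E)` is trivial.
  set K : ℝ := k * N (incl 0 (vacuum A E)) + 1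
  have hK : 0 < K := add_pos_of_nonneg_of_pos (mul_nonneg hk.le (apply_nonneg N _)) one_pos
  have hle : ∀ (n : ℕ) (ξ : Fin n → G), ‖tprod A n fun i => (ξ i : E)‖ ≤ K * s ^ n := by
    intro n ξ
    have h := (hkN (incl n (tprod A n fun i => (ξ i : E)))).1.trans (hNt n ξ)
    rw [norm_incl, inv_mul_le_iff₀ hk] at h
    calc _ ≤ k * (s ^ n * N (incl 0 (vacuum A E))) := h
      _ = (k * N (incl 0 (vacuum A E))) * s ^ n := by ring
      _ ≤ K * s ^ n := by
        gcongr
        exact le_add_of_nonneg_right zero_le_one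
  have hlim : Tendsto (fun n : ℕ => K ^ (1 / (n : ℝ)) * s) atTop (𝓝 (K ^ (0 : ℝ) * s)) :=
    ((tendsto_const_nhds.rpow tendsto_one_div_atTop_nhds_zero_nat (.inl hK.ne'))).mul_const s
  rw [Real.rpow_zero, one_mul] at hlim
  refine le_of_tendsto_of_tendsto (tendsto_radiusSeq hne hC) hlim ?_
  filter_upwards [eventually_ne_atTop 0] with n hn
  refine ciSup_le fun ξ => ?_
  calc _ ≤ (K * s ^ n) ^ (1 / (n : ℝ)) :=
        Real.rpow_le_rpow (norm_nonneg _) (hle n ξ) (by positivity)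
    _ = K ^ (1 / (n : ℝ)) * s := by
        rw [Real.mul_rpow hK.le (by positivity), one_div, Real.pow_rpow_inv_natCast hs0 hn]

/-! ### Renorming the Fock module -/

theorem jointSpectralRadius_nonneg (hne : G.Nonempty) (hC : ∀ ξ ∈ G, ‖ξ‖ ≤ C) :
    0 ≤ jointSpectralRadius A G :=
  ge_of_tendsto' (tendsto_radiusSeq hne hC) fun _ => Real.iSup_nonneg fun _ => by positivity

/-- The operators of left multiplication by `r⁻ⁿ ξ₁ ⊙ ⋯ ⊙ ξₙ` form a bounded monoid when
`r > ρ_E(G)`, which gives an equivalent norm `p` on `F(E)` with `p(ξ ⊙ Z) ≤ r p(Z)`. -/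
theorem exists_seminorm_leftMul_le (hne : G.Nonempty) (hC : ∀ ξ ∈ G, ‖ξ‖ ≤ C) {r : ℝ}
    (hr : jointSpectralRadius A G < r) :
    ∃ (p : Seminorm ℂ (FockModule A E)) (M : ℝ), 0 < M ∧ (∀ Z, ‖Z‖ ≤ p Z) ∧
      (∀ Z, p Z ≤ M * ‖Z‖) ∧ ∀ ξ ∈ G, ∀ Z, p (leftMul (ofE A ξ) Z) ≤ r * p Z := by
  have hr0 : 0 < r := (jointSpectralRadius_nonneg hne hC).trans_lt hr
  obtain ⟨M, hM0, hM⟩ := exists_norm_tprod_le_mul_pow hne hC hr0 hr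
  let S : Submonoid (FockModule A E →L[ℂ] FockModule A E) :=
    Submonoid.closure (Set.range fun ξ : G => ((r⁻¹ : ℝ) : ℂ) • leftMul (ofE A (ξ : E)))
  have hS : ∀ s ∈ S, ∃ (n : ℕ) (ξ : Fin n → G),
      s = (((r⁻¹ : ℝ) : ℂ) ^ n) • leftMul (tprod A n fun i => (ξ i : E)) := by
    intro s hs
    induction hs using Submonoid.closure_induction_left with
    | one =>
      refine ⟨0, Fin.elim0, ?_⟩
      rw [pow_zero, one_smul]
      exact (leftMul_vacuum A E).symm
    | mul_left x hx y hy ih =>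
      obtain ⟨g, rfl⟩ := hx
      obtain ⟨n, ξ, rfl⟩ := ih
      refine ⟨n + 1, Fin.cons g ξ, ?_⟩
      change _ = (((r⁻¹ : ℝ) : ℂ) ^ (n + 1)) •
        leftMul (odot (ofE A (g : E)) (tprod A n fun i => (ξ i : E)))
      rw [leftMul_odot, smul_mul_smul_comm, pow_succ']
  have hSM : ∀ s ∈ S, ‖s‖ ≤ M := by
    intro s hs
    obtain ⟨n, ξ, rfl⟩ := hS s hs
    rw [norm_smul, norm_pow, Complex.norm_real, Real.norm_of_nonneg (by positivity), norm_leftMul,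
      inv_pow, inv_mul_le_iff₀ (by positivity), mul_comm]
    exact hM n ξ
  obtain ⟨p, hp1, hp2, hp3⟩ := exists_seminorm_forall_mem_le S hSM
  refine ⟨p, M, hM0, hp1, hp2, fun ξ hξ Z => ?_⟩
  have h := hp3 _ (Submonoid.subset_closure ⟨⟨ξ, hξ⟩, rfl⟩) Z
  change p (((r⁻¹ : ℝ) : ℂ) • leftMul (ofE A ξ) Z) ≤ p Z at h
  rwa [map_smul_eq_mul, Complex.norm_real, Real.norm_of_nonneg (by positivity),
    inv_mul_le_iff₀ hr0] at h

/-- The operator norm `N(X) = sup {p(X ⊙ Y) : Y homogeneous, p(Y) ≤ 1}` of right multiplication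
by homogeneous elements, with respect to a norm `p` equivalent to the usual one, is an
`IsFockNorm`. -/
theorem exists_isFockNorm_of_seminorm (p : Seminorm ℂ (FockModule A E)) {M : ℝ} (hM : 0 < M)
    (hp1 : ∀ Z, ‖Z‖ ≤ p Z) (hp2 : ∀ Z, p Z ≤ M * ‖Z‖) :
    ∃ N : Seminorm ℂ (FockModule A E), IsFockNorm N ∧ ∀ (X : FockModule A E) (c : ℝ), 0 ≤ c →
      (∀ (n : ℕ) (Y : TensorPow A E n), p (rightMul X Y) ≤ c * p (incl n Y)) → N X ≤ c := by
  let I := {Y : Σ n, TensorPow A E n // p (incl Y.1 Y.2) ≤ 1}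
  let q : I → Seminorm ℂ (FockModule A E) := fun Y => p.comp (rightMul.flip Y.1.2).toLinearMap
  have hqa : ∀ Y X, q Y X = p (rightMul X Y.1.2) := fun _ _ => rfl
  have hI : Nonempty I := ⟨⟨⟨0, 0⟩, by simp⟩⟩
  have hq : ∀ Y X, q Y X ≤ M * ‖X‖ := fun Y X => by
    have hY : ‖Y.1.2‖ ≤ 1 := by
      rw [← norm_incl]
      exact (hp1 _).trans Y.2
    calc q Y X ≤ M * ‖rightMul X Y.1.2‖ := hp2 _
      _ ≤ M * (‖X‖ * ‖Y.1.2‖) := by gcongr; exact norm_rightMul_apply_le _ _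
      _ ≤ M * ‖X‖ := by gcongr; exact mul_le_of_le_one_right (norm_nonneg _) hY
  have hbdd : BddAbove (Set.range q) :=
    Seminorm.bddAbove_range_iff.2 fun X => ⟨_, Set.forall_mem_range.2 fun Y => hq Y X⟩
  have hle : ∀ Y X, q Y X ≤ (⨆ Y, q Y) X := fun Y X => by
    rw [Seminorm.iSup_apply hbdd]
    exact le_ciSup (f := fun Y => q Y X) ⟨_, Set.forall_mem_range.2 fun Y => hq Y X⟩ Y
  have hle' : ∀ X (c : ℝ), (∀ Y, q Y X ≤ c) → (⨆ Y, q Y) X ≤ c := fun X c h => by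
    rw [Seminorm.iSup_apply hbdd]
    exact ciSup_le h
  have hmul : ∀ (X : FockModule A E) (n : ℕ) (Y : TensorPow A E n),
      p (rightMul X Y) ≤ (⨆ Y, q Y) X * p (incl n Y) := by
    intro X n Y
    rcases (apply_nonneg p (incl n Y)).eq_or_lt with h | h
    · have hY : Y = 0 := by
        rw [← norm_le_zero_iff, ← norm_incl, h]
        exact hp1 _
      rw [hY]
      simp
    · set t := p (incl n Y)
      have ht : ‖(((t⁻¹ : ℝ)) : ℂ)‖ = t⁻¹ := by
        rw [Complex.norm_real, Real.norm_of_nonneg (by positivity)]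
      have h1 : p (incl n (((t⁻¹ : ℝ) : ℂ) • Y)) ≤ 1 := by
        rw [map_smul, map_smul_eq_mul, ht]
        exact (inv_mul_cancel₀ h.ne').le
      have h2 := hle ⟨⟨n, ((t⁻¹ : ℝ) : ℂ) • Y⟩, h1⟩ X
      rw [hqa, map_smul, map_smul_eq_mul, ht, inv_mul_le_iff₀ h] at h2
      rwa [mul_comm]
  refine ⟨⨆ Y, q Y, ⟨⟨M, hM, fun X => ⟨?_, hle' X _ fun Y => hq Y X⟩⟩, ?_⟩, ?_⟩
  · have h := hmul X 0 (vacuum A E)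
    rw [rightMul_vacuum] at h
    have hv : p (incl 0 (vacuum A E)) ≤ M := by
      refine (hp2 _).trans ?_
      rw [norm_incl]
      exact mul_le_of_le_one_right hM.le (norm_vacuum_le A E)
    rw [inv_mul_le_iff₀ hM, mul_comm]
    exact (hp1 X).trans (h.trans (mul_le_mul_of_nonneg_left hv (apply_nonneg _ _)))
  · intro m n X Y
    refine hle' _ _ fun Z => ?_
    rw [hqa, rightMul_incl_odot]
    refine (hmul _ _ _).trans (mul_le_mul_of_nonneg_left ?_ (apply_nonneg _ _))
    rw [← rightMul_incl]
    exact hle Z _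
  · intro X c hc h
    exact hle' X c fun Y => (h _ _).trans (mul_le_of_le_one_right hc Y.2)

/-- For every `r > ρ_E(G)` there is a norm in the family with `sup_{ξ ∈ G} N(ξ) ≤ r`. -/
theorem exists_isFockNorm_iSup_le (hne : G.Nonempty) (hC : ∀ ξ ∈ G, ‖ξ‖ ≤ C) {r : ℝ}
    (hr : jointSpectralRadius A G < r) :
    ∃ N : Seminorm ℂ (FockModule A E), IsFockNorm N ∧
      ⨆ ξ : G, N (incl 1 (ofE A (ξ : E))) ≤ r := by
  have hr0 : 0 ≤ r := (jointSpectralRadius_nonneg hne hC).trans hr.le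
  obtain ⟨p, M, hM, hp1, hp2, hp3⟩ := exists_seminorm_leftMul_le hne hC hr
  obtain ⟨N, hN, hNle⟩ := exists_isFockNorm_of_seminorm p hM hp1 hp2
  refine ⟨N, hN, Real.iSup_le (fun ξ => hNle _ r hr0 fun n Y => ?_) hr0⟩
  rw [rightMul_incl, ← leftMul_incl]
  exact hp3 _ ξ.2 _

end Radius

end HilbertBimodule

theorem mainTheorem4 {A E : Type*} [CStarAlgebra A] [PartialOrder A] [StarOrderedRing A]
    [NormedAddCommGroup E] [NormedSpace ℂ E] [CompleteSpace E] [Module A E] [Module Aᵐᵒᵖ E]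
    [HilbertBimodule A E] (G : Set E) (hne : G.Nonempty) (hbdd : Bornology.IsBounded G) :
    Tendsto (fun n : ℕ => ⨆ ξ : Fin n → G,
        ‖HilbertBimodule.tprod A n (fun i => (ξ i : E))‖ ^ (1 / (n : ℝ)))
      atTop (𝓝 (HilbertBimodule.jointSpectralRadius A G)) ∧
    IsGLB {r : ℝ | ∃ N : Seminorm ℂ (HilbertBimodule.FockModule A E),
        HilbertBimodule.IsFockNorm N ∧
          r = ⨆ ξ : G, N (HilbertBimodule.incl 1 (HilbertBimodule.ofE A (ξ : E)))}
      (HilbertBimodule.jointSpectralRadius A G) := by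
  obtain ⟨C, hC⟩ := hbdd.exists_norm_le
  refine ⟨HilbertBimodule.tendsto_radiusSeq hne hC, ?_, fun b hb => ?_⟩
  · rintro _ ⟨N, hN, rfl⟩
    exact HilbertBimodule.jointSpectralRadius_le hne hC hN
  · refine le_of_forall_gt_imp_ge_of_dense fun r hr => ?_
    obtain ⟨N, hN, hle⟩ := HilbertBimodule.exists_isFockNorm_iSup_le hne hC hr
    exact (hb ⟨N, hN, rfl⟩).trans hle
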